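/- For $n \ge 0$ let $\mathsf{L}_2^{(n)}$ (the Toffoli ladder) be the operator on $2n+1$ qubits which acts on the computational basis states, with $x_i \in \{0,1\}$, by $$\mathsf{L}_2^{(n)} \Big(\bigotimes_{i=0}^{2n} |x_i\rangle\Big) = |x_0\rangle \otimes \bigotimes_{i=1}^{n} |x_{2i-1}\rangle\, |x_{2i} \oplus x_{2i-2}x_{2i-1}\rangle .$$ An $\mathsf{MCX}$ gate with a set $S$ of control qubits and a target qubit $t \notin S$ replaces $x_t$ by $x_t \oplus \prod_{i \in S} x_i$ and keeps all the other bits; it is a Toffoli gate if $|S| = 2$ and an $\mathsf{X}$ gate if $S = \emptyset$. The depth of a circuit is the number of time steps it needs when gates acting on disjoint sets of qubits may be performed in the same time step. There exist circuits $C_n$ ($n \ge 0$) over the gate set $\{\text{Toffoli}, \mathsf{X}\}$ such that $C_n$ acts on exactly $2n+1$ qubits (no ancilla qubits are used), $C_n$ implements $\mathsf{L}_2^{(n)}$, and, as $n \to \infty$, $C_n$ has depth $O(\log^2 n)$ and consists of $O(n \log n)$ gates. Moreover, $C_n$ can be chosen of the following form. There is a sequence of $O(\log n)$ layers of $\mathsf{MCX}$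 gates on the $2n+1$ qubits, no two gates of one layer sharing a qubit, whose composition is $\mathsf{L}_2^{(n)}$, and $C_n$ is obtained by replacing each $\mathsf{MCX}$ gate $g$ of each layer by a $\{\text{Toffoli}, \mathsf{X}\}$ circuit which implements $g$ and acts only on the qubits of $g$ and on a set of dirty ancilla qubits (qubits in an arbitrary state, which is restored), chosen among the qubits of the register that are idle in this layer; within one layer, these sets are pairwise disjoint for different gates. -/

import Mathlib

namespace QCirc

/-- The computational basis states `|x₀, …, x_{N-1}⟩` of an `N`-qubit register. -/
abbrev BasisState (N : ℕ) : Type := Fin N → Bool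

/-- Operators on the state space `(ℂ²)^{⊗N}`, as matrices in the computational basis. -/
abbrev Operator (N : ℕ) : Type := Matrix (BasisState N) (BasisState N) ℂ

/-- The operator with action `|x⟩ ↦ |f x⟩` on the computational basis states. -/
def basisOp {N : ℕ} (f : BasisState N → BasisState N) : Operator N :=
  Matrix.of fun y x => if y = f x then 1 else 0

theorem basisOp_ket {N : ℕ} (f : BasisState N → BasisState N) (x : BasisState N) :
    (basisOp f).mulVec (Pi.single x 1) = Pi.single (f x) 1 := by
  ext y
  simp [basisOp, Pi.single_apply]

/-- A multi-controlled `X` gate placed on an `N`-qubit register: the qubits it is controlled by,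
and its target qubit. -/
structure MCX (N : ℕ) where
  controls : Finset (Fin N)
  target : Fin N
  target_notMem : target ∉ controls

namespace MCX

variable {N : ℕ}

/-- The qubits on which the gate acts. -/
def support (g : MCX N) : Finset (Fin N) := insert g.target g.controls

/-- `t ↦ t ⊕ ∏ x_i` on the target, where `i` ranges over the controls; the other bits are kept. -/
def act (g : MCX N) (x : BasisState N) : BasisState N :=
  Function.update x g.target (xor (x g.target) (decide (∀ i ∈ g.controls, x i = true)))

/-- The operator of the gate on the whole register. -/
def op (g : MCX N) : Operator N := basisOp g.act

/-- Toffoli gates have two controls, `X` gates have none. -/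
def IsToffoliOrX (g : MCX N) : Prop := g.controls.card = 2 ∨ g.controls.card = 0

end MCX

/-- A circuit of `MCX` gates on exactly `N` qubits (so without ancilla qubits);
the head of the list is applied first. Its gate count is the length of the list. -/
abbrev Circuit (N : ℕ) : Type := List (MCX N)

namespace Circuit

variable {N : ℕ}

/-- The operator implemented by a circuit. -/
noncomputable def op : Circuit N → Operator N
  | [] => 1
  | g :: c => op c * g.op

/-- All the gates of the circuit are Toffoli gates and `X` gates. -/
def IsToffoliX (c : Circuit N) : Prop := ∀ g ∈ c, g.IsToffoliOrX

/-- If the qubits are busy until the times `τ`, then the gate `g` is performed in the first time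
step in which all of its qubits are free; this gives the new times. -/
def schedule (τ : Fin N → ℕ) (g : MCX N) : Fin N → ℕ :=
  fun q => if q ∈ g.support then g.support.sup τ + 1 else τ q

/-- The depth of a circuit: the number of time steps needed, when gates that act on disjoint
sets of qubits may be performed in the same time step. -/
def depth (c : Circuit N) : ℕ := Finset.univ.sup (c.foldl schedule (fun _ => 0))

/-- A layer of parallel gates: no two of them share a qubit. -/
def IsLayer (l : Circuit N) : Prop := l.Pairwise fun g h => Disjoint g.support h.support

/-- The circuit `c` realises the layer `l` over Toffoli and `X` gates, with idle qubits as dirty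
ancillae: every gate `g` of the layer is replaced by a circuit `block g` that implements `g` (for
every initial state of the remaining qubits, which it restores) and that acts only on the qubits
of `g` and on a set `anc g` of qubits on which no gate of the layer acts. Different gates use
disjoint sets of ancillae, so that the blocks can be performed in parallel. -/
def RealisesLayer (c l : Circuit N) : Prop :=
  ∃ (anc : MCX N → Finset (Fin N)) (block : MCX N → Circuit N),
    c = l.flatMap block ∧
    l.Pairwise (fun g h => Disjoint (anc g) (anc h)) ∧
    ∀ g ∈ l,
      (∀ h ∈ l, Disjoint (anc g) h.support) ∧
      (block g).IsToffoliX ∧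
      (∀ u ∈ block g, u.support ⊆ g.support ∪ anc g) ∧
      (block g).op = g.op

end Circuit

/-- The action of the Toffoli ladder on basis states of `2n+1` qubits: for `1 ≤ i ≤ n` the bit
`x_{2i}` becomes `x_{2i} ⊕ x_{2i-2} x_{2i-1}`, and the other bits are kept. -/
def ladderTwoAct (n : ℕ) (x : BasisState (2 * n + 1)) : BasisState (2 * n + 1) :=
  fun q =>
    if Even q.val ∧ 0 < q.val then
      xor (x q) (x ⟨q.val - 2, by omega⟩ && x ⟨q.val - 1, by omega⟩)
    else x q

/-- The Toffoli ladder operator `L₂^(n)`. -/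
def ladderTwo (n : ℕ) : Operator (2 * n + 1) := basisOp (ladderTwoAct n)

end QCirc

/-!
The conjunction of many bits is computed in logarithmic depth starting from two clean ancillae. Once
a group of controls has been reduced to fewer qubits, the group itself is, after a flip, *clean on
the branch where its conjunction holds*; on the other branch the outcome is determined anyway. Hence
the workspace doubles in each round. Two of the controls can play the part of the initial clean
ancillae, and one dirty ancilla `a` is enough to write the result on the target by a commutator,
because `(a ⊕ ψ) φ ⊕ a φ = φ ψ`.

The ladder whose rungs have length `s` is a layer of rungs at the odd multiples of `2s`, followed by
the ladder with rungs of length `2s`, followed by a layer of rungs at the even multiples. Iterating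
this, the ladder becomes `O(log n)` layers. A rung of length at least `2` with target `t` leaves the
qubit `t - 2` idle, which is its dirty ancilla.
-/

namespace QCirc

variable {N : ℕ}

theorem basisOp_mul (f g : BasisState N → BasisState N) :
    basisOp f * basisOp g = basisOp (f ∘ g) := by
  ext y x
  simp [basisOp, Matrix.mul_apply]

theorem basisOp_id : basisOp (id : BasisState N → BasisState N) = 1 := by
  ext y x
  simp [basisOp, Matrix.one_apply]

/-- The map that flips the bit `t` of the basis states on which `φ` is true: a gate with target `t`
which is controlled by an arbitrary Boolean function instead of a conjunction. -/
def toggle (t : Fin N) (φ : BasisState N → Bool) (x : BasisState N) : BasisState N :=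
  Function.update x t (xor (x t) (φ x))

section toggle

variable {a t : Fin N} {φ ψ : BasisState N → Bool}

theorem toggle_apply_self (t : Fin N) (φ : BasisState N → Bool) (x : BasisState N) :
    toggle t φ x t = xor (x t) (φ x) :=
  Function.update_self ..

theorem toggle_apply_of_ne {q : Fin N} (h : q ≠ t) (φ : BasisState N → Bool) (x : BasisState N) :
    toggle t φ x q = x q :=
  Function.update_of_ne h ..

theorem toggle_false (t : Fin N) (x : BasisState N) : toggle t (fun _ => false) x = x := by
  simp [toggle]

theorem toggle_toggle (hψ : ∀ x b, ψ (Function.update x t b) = ψ x) (x : BasisState N) :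
    toggle t ψ (toggle t φ x) = toggle t (fun x => xor (φ x) (ψ x)) x := by
  simp [toggle, hψ]

theorem toggle_toggle_cancel (hφ : ∀ x b, φ (Function.update x t b) = φ x) (x : BasisState N) :
    toggle t φ (toggle t φ x) = x := by
  simp [toggle_toggle hφ, toggle_false]

theorem toggle_update_comm (hat : a ≠ t) (hψ : ∀ x b, ψ (Function.update x t b) = ψ x)
    (x : BasisState N) (b : Bool) :
    toggle a ψ (Function.update x t b) = Function.update (toggle a ψ x) t b := by
  rw [toggle, toggle, hψ, Function.update_of_ne hat, Function.update_comm hat.symm]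

theorem toggle_conj {f g : BasisState N → BasisState N} (hgf : Function.LeftInverse g f)
    (hf : ∀ x, f x t = x t) (hg : ∀ x b, g (Function.update x t b) = Function.update (g x) t b)
    (x : BasisState N) : g (toggle t φ (f x)) = toggle t (φ ∘ f) x := by
  rw [toggle, hg, hgf, hf, toggle, Function.comp_apply]

/-- The commutator that turns a qubit `a` in an unknown state into an ancilla: the state of `a`
cancels, because `(a ⊕ ψ) φ ⊕ a φ = φ ψ`. -/
theorem toggle_commutator (hat : a ≠ t) (hφa : ∀ x b, φ (Function.update x a b) = φ x)
    (hφt : ∀ x b, φ (Function.update x t b) = φ x) (hψa : ∀ x b, ψ (Function.update x a b) = ψ x)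
    (hψt : ∀ x b, ψ (Function.update x t b) = ψ x) (x : BasisState N) :
    toggle a ψ (toggle t (fun x => x a && φ x) (toggle a ψ (toggle t (fun x => x a && φ x) x))) =
      toggle t (fun x => φ x && ψ x) x := by
  have hconj (y : BasisState N) : toggle a ψ (toggle t (fun x => x a && φ x) (toggle a ψ y)) =
      toggle t (fun x => xor (x a) (ψ x) && φ x) y := by
    rw [toggle_conj (toggle_toggle_cancel hψa) (fun x => toggle_apply_of_ne hat.symm ψ x)
      (toggle_update_comm hat hψt)]
    simp [toggle, hφa]
  rw [hconj, toggle_toggle fun x b => by simp [hψt, hφt, hat]]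
  congr 1
  funext y
  cases y a <;> cases φ y <;> cases ψ y <;> rfl

end toggle

namespace MCX

theorem target_mem_support (g : MCX N) : g.target ∈ g.support :=
  Finset.mem_insert_self ..

theorem target_ne_of_disjoint {g h : MCX N} (hgh : Disjoint g.support h.support) :
    g.target ≠ h.target :=
  Finset.disjoint_left.1 hgh g.target_mem_support |> fun hn e => hn (e ▸ h.target_mem_support)

theorem act_eq_toggle (g : MCX N) :
    g.act = toggle g.target fun x => decide (∀ i ∈ g.controls, x i = true) :=
  rfl

theorem act_of_ne (g : MCX N) (x : BasisState N) {q : Fin N} (h : q ≠ g.target) :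
    g.act x q = x q := by
  rw [act_eq_toggle, toggle_apply_of_ne h]

theorem act_target (g : MCX N) (x : BasisState N) :
    g.act x g.target = xor (x g.target) (decide (∀ i ∈ g.controls, x i = true)) := by
  rw [act_eq_toggle, toggle_apply_self]

theorem act_act (g : MCX N) (x : BasisState N) : g.act (g.act x) = x := by
  rw [act_eq_toggle]
  refine toggle_toggle_cancel (fun y b => ?_) x
  congr 1
  refine propext (forall₂_congr fun i hi => ?_)
  rw [Function.update_of_ne (ne_of_mem_of_not_mem hi g.target_notMem)]

theorem eqOn_act (g : MCX N) {A : Finset (Fin N)} (hA : g.support ⊆ A) {x y : BasisState N}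
    (h : Set.EqOn x y A) : Set.EqOn (g.act x) (g.act y) A := by
  intro q hq
  by_cases hqt : q = g.target
  · subst hqt
    have hcontrols : (∀ i ∈ g.controls, x i = true) ↔ ∀ i ∈ g.controls, y i = true :=
      forall₂_congr fun i hi => by rw [h (hA (Finset.mem_insert_of_mem hi))]
    simp only [act_target, h hq, hcontrols]
  · rw [act_of_ne _ _ hqt, act_of_ne _ _ hqt, h hq]

/-- The Toffoli gate with controls `a`, `b` and target `t`. -/
def toffoli (a b t : Fin N) (ha : t ≠ a) (hb : t ≠ b) : MCX N where
  controls := {a, b}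
  target := t
  target_notMem := by simp [ha, hb]

/-- The `X` gate on the qubit `t`. -/
def not (t : Fin N) : MCX N where
  controls := ∅
  target := t
  target_notMem := Finset.notMem_empty t

theorem toffoli_act {a b t : Fin N} (ha : t ≠ a) (hb : t ≠ b) :
    (toffoli a b t ha hb).act = toggle t fun x => x a && x b := by
  funext x
  simp [act_eq_toggle, toffoli]

theorem not_act (t : Fin N) : (not t).act = toggle t fun _ => true := by
  funext x
  simp [act_eq_toggle, not]

end MCX

namespace Circuit

/-- The action of a circuit on the basis states. -/
def run (c : Circuit N) (x : BasisState N) : BasisState N := c.foldl (fun x g => g.act x) x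

@[simp] theorem run_nil (x : BasisState N) : run [] x = x := rfl

@[simp] theorem run_cons (g : MCX N) (c : Circuit N) (x : BasisState N) :
    run (g :: c) x = run c (g.act x) := rfl

@[simp] theorem run_append (c c' : Circuit N) (x : BasisState N) :
    run (c ++ c') x = run c' (run c x) := List.foldl_append

theorem op_eq_basisOp_run (c : Circuit N) : c.op = basisOp c.run := by
  induction c with
  | nil => exact basisOp_id.symm
  | cons g c ih =>
    rw [op, ih, MCX.op, basisOp_mul]
    rfl

theorem run_reverse_run (c : Circuit N) (x : BasisState N) : run c.reverse (run c x) = x := by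
  induction c generalizing x with
  | nil => rfl
  | cons g c ih => simp [ih, g.act_act]

theorem run_of_forall_target_ne {c : Circuit N} {q : Fin N} (h : ∀ g ∈ c, g.target ≠ q)
    (x : BasisState N) : run c x q = x q := by
  induction c generalizing x with
  | nil => rfl
  | cons g c ih =>
    rw [List.forall_mem_cons] at h
    rw [run_cons, ih h.2, g.act_of_ne x h.1.symm]

/-- The circuits that act on the qubits of `A` only, with at most `k` Toffoli and `X` gates and, by
their very construction from parallel and sequential parts, in at most `d` time steps. Unlike a
bound on `depth`, this notion is visibly invariant under reversal. -/
inductive Bounded : Finset (Fin N) → ℕ → ℕ → Circuit N → Prop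
  | nil (A : Finset (Fin N)) : Bounded A 0 0 []
  | singleton {A : Finset (Fin N)} {g : MCX N} (hg : g.IsToffoliOrX) (hA : g.support ⊆ A) :
      Bounded A 1 1 [g]
  | append {A : Finset (Fin N)} {d d' k k' : ℕ} {c c' : Circuit N} (h : Bounded A d k c)
      (h' : Bounded A d' k' c') : Bounded A (d + d') (k + k') (c ++ c')
  | par {A A' : Finset (Fin N)} {d k k' : ℕ} {c c' : Circuit N} (hA : Disjoint A A')
      (h : Bounded A d k c) (h' : Bounded A' d k' c') : Bounded (A ∪ A') d (k + k') (c ++ c')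
  | mono {A A' : Finset (Fin N)} {d d' k k' : ℕ} {c : Circuit N} (h : Bounded A d k c)
      (hA : A ⊆ A') (hd : d ≤ d') (hk : k ≤ k') : Bounded A' d' k' c

namespace Bounded

variable {A : Finset (Fin N)} {d k : ℕ} {c : Circuit N}

theorem isToffoliX (h : Bounded A d k c) : c.IsToffoliX := by
  induction h with
  | nil => exact List.forall_mem_nil _
  | singleton hg => exact List.forall_mem_singleton.2 hg
  | append _ _ ih ih' | par _ _ _ ih ih' => exact List.forall_mem_append.2 ⟨ih, ih'⟩
  | mono _ _ _ _ ih => exact ih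

theorem support_subset (h : Bounded A d k c) : ∀ g ∈ c, g.support ⊆ A := by
  induction h with
  | nil => exact List.forall_mem_nil _
  | singleton _ hA => exact List.forall_mem_singleton.2 hA
  | append _ _ ih ih' => exact List.forall_mem_append.2 ⟨ih, ih'⟩
  | par _ _ _ ih ih' =>
    exact List.forall_mem_append.2 ⟨fun g hg => (ih g hg).trans Finset.subset_union_left,
      fun g hg => (ih' g hg).trans Finset.subset_union_right⟩
  | mono _ hA _ _ ih => exact fun g hg => (ih g hg).trans hA

theorem length_le (h : Bounded A d k c) : c.length ≤ k := by
  induction h with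
  | nil | singleton => exact le_rfl
  | append _ _ ih ih' | par _ _ _ ih ih' => rw [List.length_append]; exact add_le_add ih ih'
  | mono _ _ _ hk ih => exact ih.trans hk

theorem reverse (h : Bounded A d k c) : Bounded A d k c.reverse := by
  induction h with
  | nil A => exact nil A
  | singleton hg hA => exact singleton hg hA
  | append _ _ ih ih' =>
    rw [List.reverse_append]
    exact (ih'.append ih).mono le_rfl (add_comm ..).le (add_comm ..).le
  | par hA _ _ ih ih' =>
    rw [List.reverse_append]
    exact (par hA.symm ih' ih).mono (Finset.union_comm ..).le le_rfl (add_comm ..).le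
  | mono _ hA hd hk ih => exact ih.mono hA hd hk

theorem run_of_notMem (h : Bounded A d k c) (x : BasisState N) {q : Fin N} (hq : q ∉ A) :
    c.run x q = x q :=
  run_of_forall_target_ne
    (fun g hg => ne_of_mem_of_not_mem (h.support_subset g hg g.target_mem_support) hq) x

theorem eqOn_run (h : Bounded A d k c) {x y : BasisState N} (hxy : Set.EqOn x y A) :
    Set.EqOn (c.run x) (c.run y) A := by
  replace h := h.support_subset
  induction c generalizing x y with
  | nil => exact hxy
  | cons g c ih =>
    rw [List.forall_mem_cons] at h
    exact ih (g.eqOn_act h.1 hxy) h.2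

theorem run_update (h : Bounded A d k c) {t : Fin N} (ht : t ∉ A) (x : BasisState N) (b : Bool) :
    c.run (Function.update x t b) = Function.update (c.run x) t b := by
  have hx : Set.EqOn (Function.update x t b) x A := fun q hq =>
    Function.update_of_ne (ne_of_mem_of_not_mem (Finset.mem_coe.1 hq) ht) ..
  funext q
  by_cases hq : q ∈ A
  · rw [h.eqOn_run hx hq, Function.update_of_ne (ne_of_mem_of_not_mem hq ht)]
  · simp only [h.run_of_notMem _ hq, Function.update_apply]

theorem foldl_schedule_of_notMem (h : Bounded A d k c) (τ : Fin N → ℕ) {q : Fin N} (hq : q ∉ A) :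
    c.foldl schedule τ q = τ q := by
  replace h := h.support_subset
  induction c generalizing τ with
  | nil => rfl
  | cons g c ih =>
    rw [List.forall_mem_cons] at h
    rw [List.foldl_cons, ih _ h.2, schedule, if_neg fun hg => hq (h.1 hg)]

theorem foldl_schedule_le (h : Bounded A d k c) {τ : Fin N → ℕ} {T : ℕ} (hτ : ∀ q ∈ A, τ q ≤ T) :
    ∀ q ∈ A, c.foldl schedule τ q ≤ T + d := by
  induction h generalizing τ T with
  | nil => exact hτ
  | singleton _ hA =>
    intro q hq
    simp only [List.foldl_cons, List.foldl_nil, schedule]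
    split_ifs
    · exact Nat.succ_le_succ (Finset.sup_le fun p hp => hτ p (hA hp))
    · exact (hτ q hq).trans (Nat.le_succ T)
  | append _ _ ih ih' =>
    intro q hq
    rw [List.foldl_append, ← add_assoc]
    exact ih' (ih hτ) q hq
  | @par _ A' _ _ _ _ _ hA h h' ih ih' =>
    intro q hq
    rw [List.foldl_append]
    by_cases hq' : q ∈ A'
    · refine ih' (fun p hp => ?_) q hq'
      rw [h.foldl_schedule_of_notMem τ (Finset.disjoint_right.1 hA hp)]
      exact hτ p (Finset.mem_union_right _ hp)
    · rw [h'.foldl_schedule_of_notMem _ hq']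
      exact ih (fun p hp => hτ p (Finset.mem_union_left _ hp)) q
        ((Finset.mem_union.1 hq).resolve_right hq')
  | @mono A _ _ _ _ _ _ h hA hd _ ih =>
    intro q hq
    by_cases hqA : q ∈ A
    · exact (ih (fun p hp => hτ p (hA hp)) q hqA).trans (by omega)
    · rw [h.foldl_schedule_of_notMem τ hqA]
      exact (hτ q hq).trans (by omega)

theorem depth_le (h : Bounded A d k c) : c.depth ≤ d := by
  refine Finset.sup_le fun q _ => ?_
  simpa using (h.mono (Finset.subset_univ A) le_rfl le_rfl).foldl_schedule_le
    (τ := fun _ => 0) (T := 0) (fun _ _ => le_rfl) q (Finset.mem_univ q)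

theorem flatMap {ι : Type*} {l : List ι} {f : ι → Circuit N} {B : ι → Finset (Fin N)}
    {k : ι → ℕ} (hB : l.Pairwise fun i j => Disjoint (B i) (B j))
    (h : ∀ i ∈ l, Bounded (B i) d (k i) (f i)) :
    Bounded {q | ∃ i ∈ l, q ∈ B i} d (l.map k).sum (l.flatMap f) := by
  induction l with
  | nil => exact (nil _).mono le_rfl (Nat.zero_le d) le_rfl
  | cons i l ih =>
    rw [List.pairwise_cons] at hB
    rw [List.forall_mem_cons] at h
    rw [List.flatMap_cons, List.map_cons, List.sum_cons]
    refine (par ?_ h.1 (ih hB.2 h.2)).mono (fun q => by simp) le_rfl le_rfl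
    simpa [Finset.disjoint_left] using fun q hq j hj hqj =>
      Finset.disjoint_left.1 (hB.1 j hj) hq hqj

end Bounded

theorem Bounded.toffoli {A : Finset (Fin N)} {a b t : Fin N} (hta : t ≠ a) (htb : t ≠ b)
    (hab : a ≠ b) (ht : t ∈ A) (ha : a ∈ A) (hb : b ∈ A) :
    Bounded A 1 1 [MCX.toffoli a b t hta htb] :=
  .singleton (.inl (Finset.card_pair hab)) <|
    Finset.insert_subset ht (Finset.insert_subset ha (Finset.singleton_subset_iff.2 hb))

theorem exists_disjoint_union_of_card_eq_add {α : Type*} [DecidableEq α] {S : Finset α} {m n : ℕ}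
    (h : S.card = m + n) : ∃ A B, Disjoint A B ∧ S = A ∪ B ∧ A.card = m ∧ B.card = n := by
  obtain ⟨A, hAS, hA⟩ := Finset.exists_subset_card_eq (s := S) (n := m) (by lia)
  exact ⟨A, S \ A, Finset.disjoint_sdiff, (Finset.union_sdiff_of_subset hAS).symm, hA,
    by rw [Finset.card_sdiff_of_subset hAS]; lia⟩

theorem exists_flip (A : Finset (Fin N)) :
    ∃ c : Circuit N, Bounded A 1 A.card c ∧ ∀ x, ∀ q ∈ A, c.run x q = !x q := by
  induction A using Finset.induction_on with
  | empty => exact ⟨[], (Bounded.nil ∅).mono le_rfl zero_le_one le_rfl, by simp⟩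
  | insert a A ha ih =>
    obtain ⟨c, hc, hcx⟩ := ih
    have hnot : Bounded {a} 1 1 [MCX.not a] := .singleton (.inr rfl) le_rfl
    refine ⟨_, (hnot.par (Finset.disjoint_singleton_left.2 ha) hc).mono le_rfl le_rfl
      (by rw [Finset.card_insert_of_notMem ha, add_comm]), fun x q hq => ?_⟩
    rw [run_append, run_cons, run_nil, MCX.not_act]
    rcases Finset.mem_insert.1 hq with rfl | hqA
    · rw [hc.run_of_notMem _ ha, toggle_apply_self, Bool.xor_true]
    · rw [hcx _ q hqA, toggle_apply_of_ne (ne_of_mem_of_not_mem hqA ha)]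

/-- The conjunction of the qubits of `S` can be reduced to the conjunction of the qubits of `R`, in
depth `d` and with `k` gates: after a circuit on `Z ∪ S`, all the qubits of `R` are true if and only
if all the qubits of `S` were true before, provided that the workspace `Z` was clean, that is,
false. The circuit changes only the qubits of `M`. -/
def ReducesAnd (M Z S R : Finset (Fin N)) (d k : ℕ) : Prop :=
  R ⊆ Z ∪ S ∧ ∃ c : Circuit N, Bounded (Z ∪ S) d k c ∧ (∀ x, ∀ q ∉ M, c.run x q = x q) ∧
    ∀ x, (∀ q ∈ Z, x q = false) → ((∀ q ∈ R, c.run x q = true) ↔ ∀ q ∈ S, x q = true)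

namespace ReducesAnd

variable {M M' M₁ M₂ M₃ Z Z' Z₂ S S' R R' R₂ R₃ A W Y : Finset (Fin N)}
  {d d' d₁ k k' k₁ k₂ k₃ : ℕ}

theorem mono (h : ReducesAnd M Z S R d k) (hM : M ⊆ M') (hZ : Z ⊆ Z') (hd : d ≤ d')
    (hk : k ≤ k') : ReducesAnd M' Z' S R d' k' := by
  obtain ⟨hR, c, hc, hM', hand⟩ := h
  have hZS : Z ∪ S ⊆ Z' ∪ S := Finset.union_subset_union_left hZ
  exact ⟨hR.trans hZS, c, hc.mono hZS hd hk, fun x q hq => hM' x q fun h => hq (hM h),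
    fun x hx => hand x fun q hq => hx q (hZ hq)⟩

theorem refl (S : Finset (Fin N)) : ReducesAnd ∅ ∅ S S 0 0 :=
  ⟨Finset.subset_union_right, [], .nil _, fun _ _ _ => rfl, fun _ _ => Iff.rfl⟩

theorem trans (h : ReducesAnd M Z S R d k) (h' : ReducesAnd M' Z' R R' d' k')
    (hMZ : Disjoint M Z') : ReducesAnd (M ∪ M') (Z ∪ Z') S R' (d + d') (k + k') := by
  obtain ⟨hR, c, hc, hM, hand⟩ := h
  obtain ⟨hR', c', hc', hM', hand'⟩ := h'
  have hZS : Z ∪ S ⊆ Z ∪ Z' ∪ S := Finset.union_subset_union_left Finset.subset_union_left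
  have hZR : Z' ∪ R ⊆ Z ∪ Z' ∪ S :=
    Finset.union_subset (Finset.subset_union_right.trans Finset.subset_union_left) (hR.trans hZS)
  refine ⟨hR'.trans hZR, c ++ c', (hc.mono hZS le_rfl le_rfl).append (hc'.mono hZR le_rfl le_rfl),
    fun x q hq => ?_, fun x hx => ?_⟩
  · rw [Finset.mem_union, not_or] at hq
    rw [run_append, hM' _ q hq.2, hM x q hq.1]
  · rw [run_append, hand' _ fun q hq => ?_, hand x fun q hq => hx q (Finset.mem_union_left _ hq)]
    rw [hM x q (Finset.disjoint_right.1 hMZ hq), hx q (Finset.mem_union_right _ hq)]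

theorem union (h : ReducesAnd M Z S R d k) (h' : ReducesAnd M' Z' S' R' d k')
    (hd : Disjoint (Z ∪ S) (Z' ∪ S')) :
    ReducesAnd (M ∪ M') (Z ∪ Z') (S ∪ S') (R ∪ R') d (k + k') := by
  obtain ⟨hR, c, hc, hM, hand⟩ := h
  obtain ⟨hR', c', hc', hM', hand'⟩ := h'
  have hU : Z ∪ S ∪ (Z' ∪ S') = Z ∪ Z' ∪ (S ∪ S') := Finset.union_union_union_comm ..
  refine ⟨hU ▸ Finset.union_subset_union hR hR', c ++ c', hU ▸ hc.par hd hc', fun x q hq => ?_,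
    fun x hx => ?_⟩
  · rw [Finset.mem_union, not_or] at hq
    rw [run_append, hM' _ q hq.2, hM x q hq.1]
  · have hcR (q) (hq : q ∈ R) : c'.run (c.run x) q = c.run x q :=
      hc'.run_of_notMem _ (Finset.disjoint_left.1 hd (hR hq))
    have hcR' (q) (hq : q ∈ R') : c'.run (c.run x) q = c'.run x q :=
      hc'.eqOn_run (fun p hp => hc.run_of_notMem x (Finset.disjoint_right.1 hd hp)) (hR' hq)
    rw [run_append, Finset.forall_mem_union, Finset.forall_mem_union,
      ← hand x fun q hq => hx q (Finset.mem_union_left _ hq),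
      ← hand' x fun q hq => hx q (Finset.mem_union_right _ hq)]
    exact and_congr (forall₂_congr fun q hq => by rw [hcR q hq])
      (forall₂_congr fun q hq => by rw [hcR' q hq])

theorem toffoli {a b u : Fin N} (hab : a ≠ b) (hua : u ≠ a) (hub : u ≠ b) :
    ReducesAnd {u} {u} {a, b} {u} 1 1 := by
  refine ⟨Finset.subset_union_left, _, .toffoli hua hub hab (by simp) (by simp) (by simp),
    fun x q hq => ?_, fun x hx => ?_⟩
  · rw [run_cons, run_nil, MCX.toffoli_act, toggle_apply_of_ne (Finset.notMem_singleton.1 hq)]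
  · simp [MCX.toffoli_act, toggle_apply_self, hx u (Finset.mem_singleton_self u)]

/-- The qubit `a` also serves as the dirty ancilla of a commutator, so that the second clean qubit
`z` is restored. -/
theorem four {u z a b c d : Fin N} (h : [u, z, a, b, c, d].Nodup) :
    ReducesAnd {u} {u, z} {a, b, c, d} {u} 6 6 := by
  simp only [List.nodup_cons, List.mem_cons, List.not_mem_nil, or_false, not_or] at h
  obtain ⟨⟨huz, hua, hub, huc, hud⟩, ⟨hza, hzb, hzc, hzd⟩, ⟨hab, hac, had⟩, -, hcd, -⟩ := h
  let ab := MCX.toffoli a b z hza hzb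
  let az := MCX.toffoli a z u hua huz
  let cd := MCX.toffoli c d a hac had
  have hrun (x) : run [ab, az, cd, az, cd, ab] x =
      toggle u (fun x => xor (x z) (x a && x b) && (x c && x d)) x := by
    have hcomm (y) : cd.act (az.act (cd.act (az.act y))) =
        toggle u (fun x => x z && (x c && x d)) y := by
      simp only [az, cd, MCX.toffoli_act]
      apply toggle_commutator <;> simp [Ne.symm, *]
    simp only [run_cons, run_nil, hcomm]
    rw [toggle_conj ab.act_act (ab.act_of_ne · huz) fun x b => ?_]
    · simp [toggle, ab, MCX.toffoli_act, Ne.symm, *]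
    · rw [MCX.toffoli_act]
      exact toggle_update_comm (Ne.symm huz) (by simp [Ne.symm, *]) x b
  refine ⟨by simp, [ab, az, cd, az, cd, ab], ?_, fun x q hq => ?_, fun x hx => ?_⟩
  · have hab' : Bounded ({u, z} ∪ {a, b, c, d}) 1 1 [ab] :=
      .toffoli _ _ hab (by simp) (by simp) (by simp)
    have haz' : Bounded ({u, z} ∪ {a, b, c, d}) 1 1 [az] :=
      .toffoli _ _ (Ne.symm hza) (by simp) (by simp) (by simp)
    have hcd' : Bounded ({u, z} ∪ {a, b, c, d}) 1 1 [cd] :=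
      .toffoli _ _ hcd (by simp) (by simp) (by simp)
    exact hab'.append (haz'.append (hcd'.append (haz'.append (hcd'.append hab'))))
  · rw [hrun, toggle_apply_of_ne (Finset.notMem_singleton.1 hq)]
  · simp [hrun, toggle_apply_self, hx, and_assoc]

theorem of_card_eq_two {u z : Fin N} (hA : A.card = 2) (huzA : Disjoint {u, z} A) :
    ReducesAnd {u} {u, z} A {u} 1 1 := by
  obtain ⟨a, b, hab, rfl⟩ := Finset.card_eq_two.1 hA
  have hu : u ≠ a ∧ u ≠ b := by simpa using Finset.disjoint_left.1 huzA (Finset.mem_insert_self u _)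
  exact (toffoli hab hu.1 hu.2).mono le_rfl (by simp) le_rfl le_rfl

theorem of_card_eq_four {u z : Fin N} (hA : A.card = 4) (huz : u ≠ z) (huzA : Disjoint {u, z} A) :
    ReducesAnd {u} {u, z} A {u} 6 6 := by
  obtain ⟨a, B, ha, rfl, hB⟩ := Finset.card_eq_succ.1 hA
  obtain ⟨b, c, d, hbc, hbd, hcd, rfl⟩ := Finset.card_eq_three.1 hB
  simp only [Finset.disjoint_insert_left, Finset.disjoint_singleton_left, Finset.mem_insert,
    Finset.mem_singleton, not_or] at ha huzA
  exact four (by simp [*])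

theorem of_card_eq_mul {m w : ℕ}
    (h : ∀ A : Finset (Fin N), A.card = m → ∀ u z, u ≠ z → Disjoint {u, z} A →
      ReducesAnd {u} {u, z} A {u} d k)
    (hW : W.card = w) (hY : Y.card = w) (hA : A.card = m * w) (hWY : Disjoint W Y)
    (hWYA : Disjoint (W ∪ Y) A) : ReducesAnd W (W ∪ Y) A W d (w * k) := by
  induction w generalizing W Y A with
  | zero =>
    rw [mul_zero, Finset.card_eq_zero] at hA
    rw [Finset.card_eq_zero] at hW
    subst hA hW
    exact (refl ∅).mono le_rfl (Finset.empty_subset _) (Nat.zero_le _) (Nat.zero_le _)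
  | succ w ih =>
    obtain ⟨u, W, huW, rfl, hWw⟩ := Finset.card_eq_succ.1 hW
    obtain ⟨z, Y, hzY, rfl, hYw⟩ := Finset.card_eq_succ.1 hY
    obtain ⟨B, C, hBC, rfl, hB, hC⟩ := exists_disjoint_union_of_card_eq_add
      (hA.trans (show m * (w + 1) = m + m * w by ring))
    simp only [Finset.disjoint_union_left, Finset.disjoint_union_right,
      Finset.disjoint_insert_left, Finset.disjoint_insert_right, Finset.mem_insert, not_or]
      at hWY hWYA
    have hB' : ReducesAnd {u} {u, z} B {u} d k := h B hB u z (by tauto) (by simp; tauto)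
    have hC' : ReducesAnd W (W ∪ Y) C W d (w * k) :=
      ih hWw hYw hC (by tauto) (by simp; tauto)
    have hd : Disjoint ({u, z} ∪ B) (W ∪ Y ∪ C) := by
      simp [*, disjoint_comm]
    have hZ : {u, z} ∪ (W ∪ Y) = insert u W ∪ insert z Y := by
      rw [Finset.insert_eq u W, Finset.insert_eq z Y, Finset.union_union_union_comm]
      rfl
    rw [Finset.insert_eq u W] at *
    exact (hB'.union hC' hd).mono le_rfl hZ.le le_rfl (by lia)

theorem exists_singleton (hS : S.Nonempty) (hd : S.card ≤ 2 ^ d) (hY : S.card ≤ Y.card + 1)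
    (hYS : Disjoint Y S) : ∃ r, ReducesAnd Y Y S {r} d (S.card - 1) := by
  induction d generalizing S Y with
  | zero =>
    obtain ⟨r, rfl⟩ := Finset.card_eq_one.1 (le_antisymm hd hS.card_pos)
    exact ⟨r, (refl _).mono (Finset.empty_subset _) (Finset.empty_subset _) le_rfl (Nat.zero_le _)⟩
  | succ d ih =>
    obtain hS₁ | hS₁ := Nat.lt_or_ge 1 S.card
    · obtain ⟨A, B, hAB, rfl, hA, hB⟩ := exists_disjoint_union_of_card_eq_add
        (show S.card = S.card / 2 + (S.card - S.card / 2) by lia)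
      rw [Finset.card_union_of_disjoint hAB] at *
      obtain ⟨u, Y, huY, rfl, hYu⟩ := Finset.card_eq_succ.1
        (show Y.card = Y.card - 1 + 1 by lia)
      obtain ⟨V, W, hVW, rfl, hV, hW⟩ := exists_disjoint_union_of_card_eq_add
        (show Y.card = A.card - 1 + (Y.card - (A.card - 1)) by lia)
      simp only [Finset.disjoint_union_left, Finset.disjoint_union_right,
        Finset.disjoint_insert_left, Finset.mem_union, not_or] at hYS huY
      obtain ⟨⟨huA, hVA, hWA⟩, huB, hVB, hWB⟩ := hYS
      obtain ⟨r, hr⟩ := ih (Finset.card_pos.1 (by lia)) (by lia) (by lia) hVA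
      obtain ⟨s, hs⟩ := ih (Finset.card_pos.1 (by lia)) (by lia) (by lia) hWB
      have hd : Disjoint (V ∪ A) (W ∪ B) := by simp [*, hWA.symm]
      have hrV : r ∈ V ∪ A := hr.1 (Finset.mem_singleton_self r)
      have hsW : s ∈ W ∪ B := hs.1 (Finset.mem_singleton_self s)
      have hu : ReducesAnd {u} {u} ({r} ∪ {s}) {u} 1 1 :=
        toffoli (Finset.disjoint_iff_ne.1 hd r hrV s hsW)
          (ne_of_mem_of_not_mem hrV (by simp [*])).symm
          (ne_of_mem_of_not_mem hsW (by simp [*])).symm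
      exact ⟨u, ((hr.union hs hd).trans hu (by simp [huY])).mono
        (Finset.union_comm ..).le (Finset.union_comm ..).le le_rfl (by lia)⟩
    · obtain ⟨r, hr⟩ := ih hS (hS₁.trans Nat.one_le_two_pow) hY hYS
      exact ⟨r, hr.mono le_rfl le_rfl (Nat.le_succ d) le_rfl⟩

theorem exists_conditionallyClean (h : ReducesAnd M Z A R d k) (hMA : Disjoint M A)
    (hZA : Disjoint Z A) (hRZ : R ⊆ Z) :
    ∃ c : Circuit N, Bounded (Z ∪ A) (d + 1) (k + A.card) c ∧
      (∀ x, ∀ q ∉ M ∪ A, c.run x q = x q) ∧ ∀ x, (∀ q ∈ Z, x q = false) →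
        ((∀ q ∈ R, c.run x q = true) ↔ ∀ q ∈ A, x q = true) ∧
        ((∀ q ∈ A, x q = true) → ∀ q ∈ A, c.run x q = false) := by
  obtain ⟨-, c, hc, hM, hand⟩ := h
  obtain ⟨f, hf, hflip⟩ := exists_flip A
  refine ⟨_, hc.append (hf.mono Finset.subset_union_right le_rfl le_rfl), fun x q hq => ?_,
    fun x hx => ⟨?_, fun hA q hq => ?_⟩⟩
  · rw [Finset.mem_union, not_or] at hq
    rw [run_append, hf.run_of_notMem _ hq.2, hM x q hq.1]
  · rw [← hand x hx, run_append]
    exact forall₂_congr fun q hq => by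
      rw [hf.run_of_notMem _ (Finset.disjoint_left.1 hZA (hRZ hq))]
  · rw [run_append, hflip _ q hq, hM x q (Finset.disjoint_right.1 hMA hq), hA q hq, Bool.not_true]

/-- If the conjunction of `A` holds, then the qubits of `A` are clean after a flip, so that they are
workspace for the conjunction of `S`; otherwise the result on `S` does not matter. -/
theorem union_of_conditionallyClean (h₁ : ReducesAnd M₁ Z A R d₁ k₁)
    (h₂ : ReducesAnd M₂ Z₂ R R₂ d k₂) (h₃ : ReducesAnd M₃ A S R₃ d k₃) (hM₁A : Disjoint M₁ A)
    (hM₁Z₂ : Disjoint M₁ Z₂) (hZ₂Z : Z₂ ⊆ Z) (hRZ : R ⊆ Z) (hZ : Disjoint Z (A ∪ S))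
    (hM₁S : Disjoint M₁ S) (hAS : Disjoint A S) :
    ReducesAnd (M₁ ∪ M₂ ∪ (A ∪ S)) Z (A ∪ S) (R₂ ∪ R₃) (d₁ + 1 + d) (k₁ + A.card + (k₂ + k₃)) := by
  have hZA : Z ∪ A ⊆ Z ∪ (A ∪ S) := Finset.union_subset_union_right Finset.subset_union_left
  have hZ₂R : Z₂ ∪ R ⊆ Z := Finset.union_subset hZ₂Z hRZ
  have hdisj : Disjoint (Z₂ ∪ R) (A ∪ S) := hZ.mono_left hZ₂R
  obtain ⟨c₁, hc₁, hM₁, hand₁⟩ := h₁.exists_conditionallyClean hM₁A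
    (hZ.mono_right Finset.subset_union_left) hRZ
  obtain ⟨hR₂, c₂, hc₂, hM₂, hand₂⟩ := h₂
  obtain ⟨hR₃, c₃, hc₃, -, hand₃⟩ := h₃
  have hc₂AS (y) (q) (hq : q ∈ A ∪ S) : c₂.run y q = y q :=
    hc₂.run_of_notMem y (Finset.disjoint_right.1 hdisj hq)
  refine ⟨Finset.union_subset_union (hR₂.trans hZ₂R) hR₃, c₁ ++ (c₂ ++ c₃),
    (hc₁.mono hZA le_rfl le_rfl).append
      ((hc₂.par hdisj hc₃).mono (Finset.union_subset_union_left hZ₂R) le_rfl le_rfl),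
    fun x q hq => ?_, fun x hx => ?_⟩
  · simp only [Finset.mem_union, not_or] at hq
    rw [run_append, run_append, hc₃.run_of_notMem _ (by simp [hq]), hM₂ _ q hq.1.2,
      hM₁ x q (by simp [hq])]
  · rw [run_append, run_append, Finset.forall_mem_union, Finset.forall_mem_union,
      forall₂_congr fun q hq => by
        rw [hc₃.run_of_notMem _ (Finset.disjoint_left.1 hdisj (hR₂ hq))],
      hand₂ _ fun q hq => ?_, (hand₁ x hx).1]
    · refine and_congr_right fun hA => ?_
      rw [hand₃ _ fun q hq => by
        rw [hc₂AS _ q (Finset.mem_union_left _ hq), (hand₁ x hx).2 hA q hq]]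
      refine forall₂_congr fun q hq => ?_
      rw [hc₂AS _ q (Finset.mem_union_right _ hq), hM₁ x q]
      rw [Finset.mem_union, not_or]
      exact ⟨Finset.disjoint_right.1 hM₁S hq, Finset.disjoint_right.1 hAS hq⟩
    · rw [hM₁ x q, hx q (hZ₂Z hq)]
      rw [Finset.mem_union, not_or]
      exact ⟨Finset.disjoint_right.1 hM₁Z₂ hq, fun hqA =>
        Finset.disjoint_left.1 hZ (hZ₂Z hq) (Finset.mem_union_left _ hqA)⟩

theorem exists_singleton_union (h₁ : ReducesAnd W (W ∪ Y) A W d₁ k₁) {r : Fin N}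
    (h₃ : ReducesAnd M A S {r} d k)
    (hW : W.Nonempty) (hWd : W.card ≤ 2 ^ d) (hWY : Disjoint W Y) (hcard : W.card ≤ Y.card)
    (hZ : Disjoint (W ∪ Y) (A ∪ S)) (hAS : Disjoint A S) :
    ∃ r, ReducesAnd Finset.univ (W ∪ Y) (A ∪ S) {r} (d₁ + d + 2) (k₁ + A.card + W.card + k) := by
  have hWpos := hW.card_pos
  obtain ⟨u, Y, huY, rfl, hY⟩ := Finset.card_eq_succ.1 (show Y.card = Y.card - 1 + 1 by lia)
  obtain ⟨huW, hWY⟩ := Finset.disjoint_insert_right.1 hWY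
  obtain ⟨s, hs⟩ := exists_singleton (Y := Y) hW hWd (by lia) hWY.symm
  have hYZ : Y ⊆ W ∪ insert u Y :=
    (Finset.subset_insert u Y).trans Finset.subset_union_right
  have hsZ : s ∈ Y ∪ W := hs.1 (Finset.mem_singleton_self s)
  have hrAS : r ∈ A ∪ S := h₃.1 (Finset.mem_singleton_self r)
  have huAS : u ∉ A ∪ S := Finset.disjoint_left.1 hZ (by simp)
  have hWAS : Disjoint W (A ∪ S) := hZ.mono_left Finset.subset_union_left
  have h := union_of_conditionallyClean h₁ hs h₃ (hWAS.mono_right Finset.subset_union_left) hWY hYZ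
    Finset.subset_union_left hZ (hWAS.mono_right Finset.subset_union_right) hAS
  have hsr : s ≠ r := Finset.disjoint_iff_ne.1 hZ s (by grind) r hrAS
  have hu : ReducesAnd {u} {u} ({s} ∪ {r}) {u} 1 1 :=
    toffoli hsr (ne_of_mem_of_not_mem hsZ (by simp [*])).symm
      (ne_of_mem_of_not_mem hrAS huAS).symm
  exact ⟨u, (h.trans hu (by simp [*])).mono (Finset.subset_univ _) (by simp) (by lia)
    (by lia)⟩

theorem exists_singleton_union_of_gadget {m w : ℕ} {r : Fin N}
    (h : ∀ A : Finset (Fin N), A.card = m → ∀ u z, u ≠ z → Disjoint {u, z} A →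
      ReducesAnd {u} {u, z} A {u} d₁ k₁)
    (h' : ReducesAnd M A S {r} d k) (hw : 0 < w) (hwd : w ≤ 2 ^ d) (hZ : Z.card = 2 * w)
    (hA : A.card = m * w) (hZAS : Disjoint Z (A ∪ S)) (hAS : Disjoint A S) :
    ∃ r, ReducesAnd Finset.univ Z (A ∪ S) {r} (d₁ + d + 2) ((k₁ + m + 1) * w + k) := by
  obtain ⟨W, Y, hWY, rfl, hW, hY⟩ := exists_disjoint_union_of_card_eq_add (hZ.trans (two_mul w))
  have hW' := of_card_eq_mul h hW hY hA hWY (hZAS.mono_right Finset.subset_union_left)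
  obtain ⟨r, hr⟩ := hW'.exists_singleton_union h'
    (Finset.card_pos.1 (by lia)) (by lia) hWY (by lia) hZAS hAS
  exact ⟨r, hr.mono le_rfl le_rfl le_rfl (by lia)⟩

end ReducesAnd

/-- The workspace doubles in each round, because the qubits that have been dealt with are
conditionally clean; `j` bounds the number of rounds. -/
theorem exists_reducesAnd {d : ℕ} (j w : ℕ) {Z S : Finset (Fin N)} (hw : 0 < w)
    (hZ : Z.card = 2 * w) (hS : S.Nonempty) (hd : S.card ≤ 2 ^ d) (hj : S.card ≤ 2 * w * 2 ^ j)
    (hZS : Disjoint Z S) :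
    ∃ r, ReducesAnd Finset.univ Z S {r} (d + 3 + 8 * j) (3 * S.card) := by
  induction j generalizing w Z S with
  | zero =>
    obtain ⟨r, hr⟩ := ReducesAnd.exists_singleton hS hd (by lia) hZS
    exact ⟨r, hr.mono (Finset.subset_univ Z) le_rfl (by lia) (by lia)⟩
  | succ j ih =>
    obtain hle | hlt := le_or_gt S.card (2 * w)
    · obtain ⟨r, hr⟩ := ReducesAnd.exists_singleton hS hd (by lia) hZS
      exact ⟨r, hr.mono (Finset.subset_univ Z) le_rfl (by lia) (by lia)⟩
    obtain hle' | hlt' := le_or_gt S.card (4 * w)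
    · obtain ⟨A, S, hAS, rfl, hA, hS'⟩ := exists_disjoint_union_of_card_eq_add
        (show S.card = 2 * w + (S.card - 2 * w) by lia)
      obtain ⟨r, hr⟩ := ReducesAnd.exists_singleton (d := d) (Finset.card_pos.1 (by lia)) (by lia)
        (by lia) hAS
      obtain ⟨r, hr⟩ := ReducesAnd.exists_singleton_union_of_gadget
        (fun _ hB _ _ _ => ReducesAnd.of_card_eq_two hB) hr hw (by lia) hZ hA hZS hAS
      exact ⟨r, hr.mono le_rfl le_rfl (by lia) (by lia)⟩
    · obtain ⟨A, S, hAS, rfl, hA, hS'⟩ := exists_disjoint_union_of_card_eq_add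
        (show S.card = 4 * w + (S.card - 4 * w) by lia)
      have hwd : w ≤ 2 ^ (d + 3 + 8 * j) :=
        (show w ≤ 2 ^ d by lia).trans (Nat.pow_le_pow_right two_pos (by lia))
      have hSj : S.card ≤ 2 * (2 * w) * 2 ^ j := by
        calc S.card ≤ 2 * w * 2 ^ (j + 1) := by lia
          _ = 2 * (2 * w) * 2 ^ j := by ring
      obtain ⟨r, hr⟩ := ih (2 * w) (by lia) (by lia) (Finset.card_pos.1 (by lia)) (by lia) hSj hAS
      obtain ⟨r, hr⟩ := ReducesAnd.exists_singleton_union_of_gadget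
        (fun _ hB _ _ => ReducesAnd.of_card_eq_four hB) hr hw hwd hZ hA hZS hAS
      exact ⟨r, hr.mono le_rfl le_rfl (by lia) (by lia)⟩

namespace Bounded

variable {C : Finset (Fin N)} {a p q r t : Fin N} {d k : ℕ} {c : Circuit N}

theorem run_update_apply (h : Bounded C d k c) (ht : t ∉ C) (hr : r ∈ C) (x : BasisState N)
    (b : Bool) : c.run (Function.update x t b) r = c.run x r := by
  rw [h.run_update ht, Function.update_of_ne (ne_of_mem_of_not_mem hr ht)]

theorem exists_run_eq_toggle (h : Bounded C d k c) (hr : r ∈ C) (ha : a ∉ C) (ht : t ∉ C)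
    (hat : a ≠ t) :
    ∃ v : Circuit N, Bounded (insert a (insert t C)) (2 * d + 1) (2 * k + 1) v ∧
      v.run = toggle t fun x => x a && c.run x r := by
  have hC : C ⊆ insert a (insert t C) := (Finset.subset_insert t C).trans (Finset.subset_insert a _)
  have har : a ≠ r := (ne_of_mem_of_not_mem hr ha).symm
  have htr : t ≠ r := (ne_of_mem_of_not_mem hr ht).symm
  have htof : Bounded (insert a (insert t C)) 1 1 [MCX.toffoli a r t hat.symm htr] :=
    .toffoli hat.symm htr har (by simp) (by simp) (hC hr)
  have hc := h.mono hC le_rfl le_rfl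
  refine ⟨_, ((hc.append htof).append hc.reverse).mono le_rfl (by lia) (by lia), ?_⟩
  funext x
  rw [run_append, run_append, run_cons, run_nil, MCX.toffoli_act,
    toggle_conj (run_reverse_run c) (h.run_of_notMem · ht) (h.reverse.run_update ht)]
  simp only [Function.comp_def, toggle, h.run_of_notMem _ ha]

theorem exists_run_eq_toggle_and (h : Bounded C d k c) (hp : p ∈ C) (hq : q ∈ C) (hr : r ∈ C)
    (hpq : p ≠ q) (ha : a ∉ C) (ht : t ∉ C) (hat : a ≠ t) :
    ∃ v : Circuit N, Bounded (insert a (insert t C)) (4 * d + 4) (4 * k + 4) v ∧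
      v.run = toggle t fun x => c.run x r && (x p && x q) := by
  obtain ⟨v, hv, hvrun⟩ := h.exists_run_eq_toggle hr ha ht hat
  have hap : a ≠ p := (ne_of_mem_of_not_mem hp ha).symm
  have haq : a ≠ q := (ne_of_mem_of_not_mem hq ha).symm
  have htof : Bounded (insert a (insert t C)) 1 1 [MCX.toffoli p q a hap haq] :=
    .toffoli hap haq hpq (by simp) (by simp [hp]) (by simp [hq])
  refine ⟨_, ((hv.append htof).append (hv.append htof)).mono le_rfl (by lia) (by lia), ?_⟩
  funext x
  simp only [run_append, run_cons, run_nil, hvrun, MCX.toffoli_act]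
  refine toggle_commutator hat (h.run_update_apply ha hr) (h.run_update_apply ht hr) ?_ ?_ x
  · simp [hap.symm, haq.symm]
  · simp [ne_of_mem_of_not_mem hp ht, ne_of_mem_of_not_mem hq ht]

end Bounded

/-- After a flip, `p` and `q` are conditionally clean workspace for the other qubits. -/
theorem exists_forall_mem_iff {C : Finset (Fin N)} {d : ℕ} (hC : 3 ≤ C.card) (hd : C.card ≤ 2 ^ d) :
    ∃ p ∈ C, ∃ q ∈ C, ∃ r ∈ C, p ≠ q ∧ ∃ c : Circuit N, Bounded C (9 * d + 4) (3 * C.card - 4) c ∧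
      ∀ x, (∀ i ∈ C, x i = true) ↔ c.run x r = true ∧ x p = true ∧ x q = true := by
  obtain ⟨Z, S, hZS, rfl, hZ, hS⟩ := exists_disjoint_union_of_card_eq_add
    (show C.card = 2 + (C.card - 2) by lia)
  have hpow : S.card ≤ 2 * 1 * 2 ^ d := by lia
  obtain ⟨r, hr, c, hc, -, hand⟩ := exists_reducesAnd d 1 one_pos hZ (Finset.card_pos.1 (by lia))
    (show S.card ≤ 2 ^ d by lia) hpow hZS
  obtain ⟨f, hf, hflip⟩ := exists_flip Z
  obtain ⟨p, q, hpq, rfl⟩ := Finset.card_eq_two.1 hZ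
  refine ⟨p, by simp, q, by simp, r, hr (Finset.mem_singleton_self r), hpq, f ++ c,
    ((hf.mono Finset.subset_union_left le_rfl le_rfl).append hc).mono le_rfl (by lia) (by lia),
    fun x => ?_⟩
  have hpair : (x p = true ∧ x q = true) ↔ ∀ i ∈ ({p, q} : Finset (Fin N)), x i = true := by simp
  rw [Finset.forall_mem_union, and_comm, hpair]
  refine and_congr_left fun hx => ?_
  have hclean (i) (hi : i ∈ ({p, q} : Finset (Fin N))) : f.run x i = false := by
    rw [hflip x i hi, hx i hi, Bool.not_true]
  simp only [Finset.mem_singleton, forall_eq] at hand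
  rw [run_append, hand _ hclean]
  exact forall₂_congr fun i hi => by rw [hf.run_of_notMem _ (Finset.disjoint_right.1 hZS hi)]

theorem exists_run_eq_act {g : MCX N} {a : Fin N} {d : ℕ} (ha : a ∉ g.support)
    (hg : 3 ≤ g.controls.card) (hd : g.controls.card ≤ 2 ^ d) :
    ∃ c : Circuit N, Bounded (insert a g.support) (36 * d + 20) (12 * g.support.card) c ∧
      c.run = g.act := by
  rw [MCX.support, Finset.mem_insert, not_or] at ha
  obtain ⟨p, hp, q, hq, r, hr, hpq, c, hc, hand⟩ := exists_forall_mem_iff hg hd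
  obtain ⟨v, hv, hrun⟩ := hc.exists_run_eq_toggle_and hp hq hr hpq ha.2 g.target_notMem ha.1
  have hcard : g.controls.card ≤ g.support.card := Finset.card_le_card (Finset.subset_insert ..)
  refine ⟨v, hv.mono le_rfl (by lia) (by lia), ?_⟩
  rw [hrun, MCX.act_eq_toggle]
  simp [hand]

theorem IsLayer.run_target {l : Circuit N} (hl : IsLayer l) (x : BasisState N) {g : MCX N}
    (hg : g ∈ l) : run l x g.target = g.act x g.target := by
  induction l generalizing x with
  | nil => cases hg
  | cons h l ih =>
    obtain ⟨hh, hl⟩ := List.pairwise_cons.1 hl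
    rw [run_cons]
    rcases List.mem_cons.1 hg with rfl | hg
    · exact run_of_forall_target_ne (fun u hu => (MCX.target_ne_of_disjoint (hh u hu)).symm) _
    · rw [ih hl _ hg]
      refine g.eqOn_act subset_rfl (fun q hq => h.act_of_ne x ?_) g.target_mem_support
      exact (ne_of_mem_of_not_mem h.target_mem_support
        (Finset.disjoint_right.1 (hh g hg) hq)).symm

theorem IsLayer.sum_card_support_le {l : Circuit N} (hl : IsLayer l) :
    (l.map fun g => g.support.card).sum ≤ N := by
  have hnodup : (l.flatMap fun g => g.support.toList).Nodup :=
    List.nodup_flatMap.2 ⟨fun g _ => g.support.nodup_toList, hl.imp fun {g h} hgh => by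
      simpa [List.disjoint_left, Finset.disjoint_left] using hgh⟩
  simpa [List.length_flatMap] using hnodup.length_le_card

theorem run_flatMap {l : Circuit N} {block : MCX N → Circuit N}
    (h : ∀ g ∈ l, (block g).run = g.act) : run (l.flatMap block) = run l := by
  induction l with
  | nil => rfl
  | cons g l ih =>
    rw [List.forall_mem_cons] at h
    funext x
    rw [List.flatMap_cons, run_append, run_cons, h.1, ih h.2]

theorem IsLayer.exists_realisesLayer {l : Circuit N} (hl : IsLayer l)
    {anc : MCX N → Finset (Fin N)} {d k : ℕ}
    (hanc : l.Pairwise fun g h => Disjoint (anc g) (anc h))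
    (hidle : ∀ g ∈ l, ∀ h ∈ l, Disjoint (anc g) h.support)
    (hblock : ∀ g ∈ l, ∃ c, Bounded (g.support ∪ anc g) d (k * g.support.card) c ∧
      c.run = g.act) :
    ∃ c, RealisesLayer c l ∧ Bounded Finset.univ d (k * N) c ∧ c.run = l.run := by
  choose! block hbounded hrun using hblock
  refine ⟨l.flatMap block, ⟨anc, block, rfl, hanc, fun g hg => ⟨hidle g hg,
    (hbounded g hg).isToffoliX, (hbounded g hg).support_subset, ?_⟩⟩, ?_, run_flatMap hrun⟩
  · rw [op_eq_basisOp_run, hrun g hg, MCX.op]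
  · have hdisjoint : l.Pairwise fun g h => Disjoint (g.support ∪ anc g) (h.support ∪ anc h) := by
      refine (hl.and hanc).imp_of_mem fun {g h} hg hh ⟨hgh, hanc⟩ => ?_
      simp only [Finset.disjoint_union_left, Finset.disjoint_union_right]
      exact ⟨⟨hgh, hidle g hg h hh⟩, (hidle h hh g hg).symm, hanc⟩
    refine (Bounded.flatMap hdisjoint hbounded).mono (Finset.subset_univ _) le_rfl ?_
    rw [List.sum_map_mul_left]
    exact Nat.mul_le_mul_left k hl.sum_card_support_le

theorem exists_forall₂_realisesLayer {L : List (Circuit N)} {A : Finset (Fin N)} {d k : ℕ}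
    (h : ∀ l ∈ L, ∃ c, RealisesLayer c l ∧ Bounded A d k c ∧ c.run = l.run) :
    ∃ R, List.Forall₂ RealisesLayer R L ∧
      Bounded A (L.length * d) (L.length * k) R.flatten ∧ run R.flatten = run L.flatten := by
  induction L with
  | nil => exact ⟨[], .nil, (Bounded.nil A).mono le_rfl (Nat.zero_le _) (Nat.zero_le _), rfl⟩
  | cons l L ih =>
    rw [List.forall_mem_cons] at h
    obtain ⟨⟨c, hcl, hc, hrun⟩, hL⟩ := h
    obtain ⟨R, hRL, hR, hruns⟩ := ih hL
    refine ⟨c :: R, .cons hcl hRL, ?_, ?_⟩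
    · rw [List.length_cons, Nat.succ_mul, Nat.succ_mul, add_comm _ d, add_comm _ k]
      exact hc.append hR
    · funext x
      rw [List.flatten_cons, List.flatten_cons, run_append, run_append, hrun, hruns]

end Circuit

/-- The gate with target `t` whose controls are the qubit `t - 2s` and the odd qubits between
`t - 2s` and `t`; for `s = 1` these gates are the Toffoli gates of the ladder. -/
def rung (s : ℕ) (t : Fin N) : MCX N where
  controls := {q | q.val < t.val ∧
    (q.val + 2 * s = t.val ∨ t.val < q.val + 2 * s ∧ q.val % 2 = 1)}
  target := t
  target_notMem := by simp

section rung

variable {s : ℕ} {p q t : Fin N}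

theorem mem_controls_rung : q ∈ (rung s t).controls ↔
    q.val < t.val ∧ (q.val + 2 * s = t.val ∨ t.val < q.val + 2 * s ∧ q.val % 2 = 1) := by
  simp [rung]

theorem mem_support_rung : q ∈ (rung s t).support ↔ q = t ∨ q ∈ (rung s t).controls :=
  Finset.mem_insert

theorem le_of_mem_support_rung (h : q ∈ (rung s t).support) :
    q.val ≤ t.val ∧ t.val ≤ q.val + 2 * s := by
  rw [mem_support_rung, mem_controls_rung] at h
  rcases h with rfl | h <;> omega

theorem rung_act_self (s : ℕ) (q : Fin N) (x : BasisState N) :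
    (rung s q).act x q = xor (x q) (decide (∀ i ∈ (rung s q).controls, x i = true)) :=
  (rung s q).act_target x

theorem forall_controls_rung (hs : 0 < s) (hpq : p.val + 2 * s = q.val) (x : BasisState N) :
    (∀ i ∈ (rung s q).controls, x i = true) ↔ x p = true ∧
      ∀ i : Fin N, p.val < i.val → i.val < q.val → i.val % 2 = 1 → x i = true := by
  simp only [mem_controls_rung]
  constructor
  · exact fun h => ⟨h p (by omega), fun i hpi hiq hi => h i (by omega)⟩
  · rintro ⟨hp, hodd⟩ i ⟨hiq, hi | hi⟩
    · rwa [show i = p from Fin.ext (by omega)]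
    · exact hodd i (by omega) hiq hi.2

theorem forall_controls_rung_two_mul (hs : 0 < s) (hp : p.val % 2 = 0) (hpq : p.val + 2 * s = q.val)
    (x : BasisState N) :
    (∀ i ∈ (rung (2 * s) q).controls, x i = true) ↔ (∀ i ∈ (rung s p).controls, x i = true) ∧
      ∀ i : Fin N, p.val < i.val → i.val < q.val → i.val % 2 = 1 → x i = true := by
  simp only [mem_controls_rung]
  refine ⟨fun h => ⟨fun i hi => h i (by omega), fun i hpi hiq hi => h i (by omega)⟩, ?_⟩
  rintro ⟨hleft, hright⟩ i hi
  rcases lt_or_ge i.val p.val with hip | hpi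
  · exact hleft i (by omega)
  · exact hright i (by omega) hi.1 (by omega)

theorem controls_rung_one (ht2 : 2 ≤ t.val) (ht : t.val % 2 = 0) :
    (rung 1 t).controls = {⟨t.val - 2, by omega⟩, ⟨t.val - 1, by omega⟩} := by
  ext q
  simp only [mem_controls_rung, Finset.mem_insert, Finset.mem_singleton, Fin.ext_iff]
  omega

theorem isToffoliOrX_rung_one (ht2 : 2 ≤ t.val) (ht : t.val % 2 = 0) :
    (rung 1 t).IsToffoliOrX := by
  left
  rw [controls_rung_one ht2 ht, Finset.card_pair]
  simp only [Ne, Fin.ext_iff]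
  omega

theorem three_le_card_controls_rung (hs : 2 ≤ s) (hst : 2 * s ≤ t.val) (ht : t.val % 2 = 0) :
    3 ≤ (rung s t).controls.card := by
  have hsub : ({⟨t.val - 2 * s, by omega⟩, ⟨t.val - 1, by omega⟩, ⟨t.val - 3, by omega⟩} :
      Finset (Fin N)) ⊆ (rung s t).controls := by
    intro q
    simp only [Finset.mem_insert, Finset.mem_singleton, Fin.ext_iff, mem_controls_rung]
    omega
  refine (Finset.card_eq_three.2 ⟨_, _, _, ?_, ?_, ?_, rfl⟩).ge.trans (Finset.card_le_card hsub)
  all_goals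
    simp only [Ne, Fin.ext_iff]
    omega

end rung

/-- The parallel rungs of length `s` whose targets are the positive qubits congruent to `r` modulo
`4s`. -/
def rungLayer (N s r : ℕ) : Circuit N :=
  ((List.finRange N).filter fun t => t.val % (4 * s) = r ∧ 0 < t.val).map (rung s)

/-- The ladder in which the rungs have length `s`. -/
def strideLadder (s : ℕ) (x : BasisState N) : BasisState N := fun q =>
  if q.val % (2 * s) = 0 ∧ 0 < q.val then (rung s q).act x q else x q

theorem add_le_of_mod_eq {m t t' : ℕ} (h : t < t') (hm : t % m = t' % m) : t + m ≤ t' := by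
  have := Nat.le_of_dvd (by omega) ((Nat.modEq_iff_dvd' h.le).1 hm)
  omega

theorem mod_four_mul_mod_two (s q : ℕ) : q % (4 * s) % 2 = q % 2 :=
  Nat.mod_mod_of_dvd q (by omega)

theorem mod_two_mul_eq_zero_iff {s : ℕ} (hs : 0 < s) (q : ℕ) :
    q % (2 * s) = 0 ↔ q % (4 * s) = 0 ∨ q % (4 * s) = 2 * s := by
  have hmod : q % (4 * s) % (2 * s) = q % (2 * s) := Nat.mod_mod_of_dvd q ⟨2, by ring⟩
  have hlt : q % (4 * s) < 4 * s := Nat.mod_lt _ (by omega)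
  rw [← hmod]
  generalize q % (4 * s) = r at hlt
  rcases lt_or_ge r (2 * s) with hr | hr
  · rw [Nat.mod_eq_of_lt hr]
    omega
  · rw [Nat.mod_eq_sub_mod hr, Nat.mod_eq_of_lt (by omega)]
    omega

section rungLayer

variable {s r : ℕ}

theorem mem_rungLayer {g : MCX N} : g ∈ rungLayer N s r ↔
    ∃ t : Fin N, (t.val % (4 * s) = r ∧ 0 < t.val) ∧ rung s t = g := by
  simp [rungLayer]

theorem isLayer_rungLayer (N s r : ℕ) : (rungLayer N s r).IsLayer := by
  rw [rungLayer, Circuit.IsLayer, List.pairwise_map]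
  refine ((List.pairwise_lt_finRange N).filter _).imp_of_mem fun {t t'} ht ht' hlt => ?_
  simp only [List.mem_filter, List.mem_finRange, true_and, decide_eq_true_eq] at ht ht'
  have hle := add_le_of_mod_eq (Fin.lt_def.1 hlt) (ht.1.trans ht'.1.symm)
  refine Finset.disjoint_left.2 fun q hq hq' => ?_
  have := le_of_mem_support_rung hq
  have := le_of_mem_support_rung hq'
  omega

theorem run_rungLayer (x : BasisState N) (q : Fin N) :
    (rungLayer N s r).run x q =
      if q.val % (4 * s) = r ∧ 0 < q.val then (rung s q).act x q else x q := by
  split_ifs with h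
  · exact (isLayer_rungLayer N s r).run_target x (mem_rungLayer.2 ⟨q, h, rfl⟩)
  · refine Circuit.run_of_forall_target_ne (fun g hg => ?_) x
    obtain ⟨t, ht, rfl⟩ := mem_rungLayer.1 hg
    rintro rfl
    exact h ht

theorem run_rungLayer_of_mod_eq (x : BasisState N) {q : Fin N} (h : q.val % (4 * s) = r)
    (hq : 0 < q.val) : (rungLayer N s r).run x q = (rung s q).act x q := by
  rw [run_rungLayer, if_pos ⟨h, hq⟩]

theorem run_rungLayer_of_mod_ne (x : BasisState N) {q : Fin N} (h : q.val % (4 * s) ≠ r) :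
    (rungLayer N s r).run x q = x q := by
  rw [run_rungLayer, if_neg fun hq => h hq.1]

theorem strideLadder_of_mod_eq (x : BasisState N) {q : Fin N} (h : q.val % (2 * s) = 0)
    (hq : 0 < q.val) : strideLadder s x q = (rung s q).act x q :=
  if_pos ⟨h, hq⟩

theorem strideLadder_of_mod_ne (x : BasisState N) {q : Fin N} (h : q.val % (2 * s) ≠ 0) :
    strideLadder s x q = x q :=
  if_neg fun hq => h hq.1

theorem strideLadder_of_le (h : N ≤ 2 * s) (x : BasisState N) : strideLadder s x = x := by
  funext q
  rw [strideLadder, Nat.mod_eq_of_lt (by omega), if_neg (by omega)]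

theorem exists_add_two_mul_eq (hs : 0 < s) {q : Fin N} (hq : q.val % (4 * s) = 0)
    (hq0 : 0 < q.val) :
    ∃ p : Fin N, 0 < p.val ∧ p.val + 2 * s = q.val ∧ p.val % (4 * s) = 2 * s := by
  have hle : 4 * s ≤ q.val := Nat.le_of_dvd hq0 (Nat.dvd_of_mod_eq_zero hq)
  refine ⟨⟨q.val - 2 * s, by omega⟩, Nat.sub_pos_of_lt (by omega),
    Nat.sub_add_cancel (by omega), ?_⟩
  obtain ⟨m, hm⟩ := Nat.exists_eq_add_of_le hle
  rw [hm, Nat.add_mod_left] at hq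
  change (q.val - 2 * s) % (4 * s) = 2 * s
  rw [show q.val - 2 * s = 2 * s + m by omega, Nat.add_mod, hq, add_zero, Nat.mod_mod,
    Nat.mod_eq_of_lt (by omega)]

/-- Write `x_p` and `x_q` for consecutive bits at the multiples of `2s`, `a` for the conjunction
that controls the rung to `x_p`, and `b` for that of the odd bits between `x_p` and `x_q`. The three
steps add `a` to `x_p`, then `a b` to `x_q`, then `(x_p ⊕ a) b` to `x_q`, so that in total `x_p b`
is added to `x_q`. -/
theorem run_rungLayer_strideLadder_apply (hs : 0 < s) (x : BasisState N) {q : Fin N}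
    (hq : q.val % (4 * s) = 0) (hq0 : 0 < q.val) :
    (rungLayer N s 0).run (strideLadder (2 * s) ((rungLayer N s (2 * s)).run x)) q =
      strideLadder s x q := by
  obtain ⟨p, hp0, hpq, hp⟩ := exists_add_two_mul_eq hs hq hq0
  have hp2 : p.val % 2 = 0 := by
    have := mod_four_mul_mod_two s p.val
    omega
  have htwo_mul : 2 * (2 * s) = 4 * s := by ring
  set y := (rungLayer N s (2 * s)).run x
  have hyx {i : Fin N} (hi : i.val % (4 * s) ≠ 2 * s) : y i = x i := run_rungLayer_of_mod_ne x hi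
  have hyp : y p = (rung s p).act x p := run_rungLayer_of_mod_eq x hp hp0
  have hzy {i : Fin N} (hi : i.val % (4 * s) ≠ 0) : strideLadder (2 * s) y i = y i :=
    strideLadder_of_mod_ne y (by rwa [htwo_mul])
  have hzq : strideLadder (2 * s) y q = (rung (2 * s) q).act y q :=
    strideLadder_of_mod_eq y (by rwa [htwo_mul]) hq0
  have hleft : (∀ i ∈ (rung s p).controls, y i = true) ↔ ∀ i ∈ (rung s p).controls, x i = true :=
    forall₂_congr fun i hi => by
      rw [mem_controls_rung] at hi
      rw [hyx fun e => by have := add_le_of_mod_eq hi.1 (e.trans hp.symm); omega]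
  have hyodd {i : Fin N} (hpi : p.val < i.val) (hiq : i.val < q.val) : y i = x i :=
    hyx fun e => by have := add_le_of_mod_eq hpi (hp.trans e.symm); omega
  have hzodd {i : Fin N} (hpi : p.val < i.val) (hiq : i.val < q.val) :
      strideLadder (2 * s) y i = x i := by
    rw [hzy fun e => by have := add_le_of_mod_eq hiq (e.trans hq.symm); omega, hyodd hpi hiq]
  rw [run_rungLayer_of_mod_eq _ hq hq0,
    strideLadder_of_mod_eq x ((mod_two_mul_eq_zero_iff hs _).2 (.inl hq)) hq0]
  simp +contextual only [rung_act_self, forall_controls_rung hs hpq, hzq,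
    hzy (hp.trans_ne (by omega)), hyp, forall_controls_rung_two_mul hs hp2 hpq, hleft, hyodd, hzodd,
    hyx (i := q) (by omega), Bool.decide_and, Bool.decide_eq_true]
  generalize decide (∀ i ∈ (rung s p).controls, x i = true) = a
  generalize decide (∀ i : Fin N, p.val < i.val → i.val < q.val → i.val % 2 = 1 → x i = true) = b
  cases x q <;> cases x p <;> cases a <;> cases b <;> rfl

theorem run_rungLayer_strideLadder (hs : 0 < s) (x : BasisState N) :
    (rungLayer N s 0).run (strideLadder (2 * s) ((rungLayer N s (2 * s)).run x)) =
      strideLadder s x := by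
  funext q
  have htwo_mul : 2 * (2 * s) = 4 * s := by ring
  by_cases hq : q.val % (4 * s) = 0 ∧ 0 < q.val
  · exact run_rungLayer_strideLadder_apply hs x hq.1 hq.2
  · rw [run_rungLayer, if_neg hq, strideLadder, htwo_mul, if_neg hq, run_rungLayer, strideLadder]
    refine if_congr ?_ rfl rfl
    rw [mod_two_mul_eq_zero_iff hs]
    tauto

end rungLayer

/-- The layers of rungs of lengths `s, 2s, …, 2^(k-1) s` with targets at the odd multiples of twice
the length, then those of lengths `2^(k-1) s, …, 2s, s` with targets at the even multiples. -/
def ladderLayers (N : ℕ) : ℕ → ℕ → List (Circuit N)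
  | 0, _ => []
  | k + 1, s => rungLayer N s (2 * s) :: (ladderLayers N k (2 * s) ++ [rungLayer N s 0])

section ladderLayers

variable {k s : ℕ}

theorem length_ladderLayers (N k s : ℕ) : (ladderLayers N k s).length = 2 * k := by
  induction k generalizing s with
  | zero => rfl
  | succ k ih =>
    rw [ladderLayers, List.length_cons, List.length_append, ih, List.length_singleton]
    ring

theorem exists_eq_rungLayer_of_mem_ladderLayers (hs : 0 < s) {l : Circuit N}
    (hl : l ∈ ladderLayers N k s) :
    ∃ s' r, 0 < s' ∧ (r = 0 ∨ r = 2 * s') ∧ l = rungLayer N s' r := by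
  induction k generalizing s with
  | zero => cases hl
  | succ k ih =>
    rw [ladderLayers, List.mem_cons, List.mem_append, List.mem_singleton] at hl
    rcases hl with rfl | hl | rfl
    · exact ⟨s, _, hs, .inr rfl, rfl⟩
    · exact ih (by omega) hl
    · exact ⟨s, _, hs, .inl rfl, rfl⟩

theorem isLayer_of_mem_ladderLayers (hs : 0 < s) {l : Circuit N} (hl : l ∈ ladderLayers N k s) :
    l.IsLayer := by
  obtain ⟨s', r, -, -, rfl⟩ := exists_eq_rungLayer_of_mem_ladderLayers hs hl
  exact isLayer_rungLayer N s' r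

theorem run_ladderLayers (hs : 0 < s) (h : N ≤ 2 ^ k * (2 * s)) :
    Circuit.run (ladderLayers N k s).flatten = strideLadder s := by
  funext x
  induction k generalizing s x with
  | zero => exact (strideLadder_of_le (by omega) x).symm
  | succ k ih =>
    rw [ladderLayers, List.flatten_cons, List.flatten_append, Circuit.run_append,
      Circuit.run_append, ih (by omega) (by rwa [pow_succ, mul_assoc] at h),
      List.flatten_singleton, run_rungLayer_strideLadder hs]

theorem strideLadder_one (n : ℕ) : strideLadder (N := 2 * n + 1) 1 = ladderTwoAct n := by
  funext x q
  simp only [strideLadder, ladderTwoAct, mul_one, Nat.even_iff]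
  split_ifs with hq
  · have h2 : 2 ≤ q.val := Nat.le_of_dvd hq.2 (Nat.dvd_of_mod_eq_zero hq.1)
    simp [rung_act_self, controls_rung_one h2 hq.1]
  · rfl

end ladderLayers

/-- The qubit two before the target, unless the gate acts on it. A rung of length at least `2` does
not act on this qubit, since it has the parity of the target. -/
def dirtyAncilla (g : MCX N) : Finset (Fin N) :=
  {q | q.val + 2 = g.target.val ∧ q ∉ g.support}

section dirtyAncilla

open Circuit

variable {s r : ℕ}

theorem mem_dirtyAncilla {g : MCX N} {q : Fin N} :
    q ∈ dirtyAncilla g ↔ q.val + 2 = g.target.val ∧ q ∉ g.support := by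
  simp [dirtyAncilla]

theorem pairwise_disjoint_dirtyAncilla {l : Circuit N} (hl : l.IsLayer) :
    l.Pairwise fun g h => Disjoint (dirtyAncilla g) (dirtyAncilla h) := by
  refine hl.imp fun {g h} hgh => Finset.disjoint_left.2 fun q hqg hqh => ?_
  rw [mem_dirtyAncilla] at hqg hqh
  exact MCX.target_ne_of_disjoint hgh (Fin.ext (hqg.1.symm.trans hqh.1))

theorem disjoint_dirtyAncilla_support (hs : 0 < s) {g h : MCX N} (hg : g ∈ rungLayer N s r)
    (hh : h ∈ rungLayer N s r) : Disjoint (dirtyAncilla g) h.support := by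
  refine Finset.disjoint_left.2 fun q hqg hqh => ?_
  obtain ⟨t, ⟨ht, -⟩, rfl⟩ := mem_rungLayer.1 hg
  obtain ⟨t', ⟨ht', -⟩, rfl⟩ := mem_rungLayer.1 hh
  obtain ⟨hqt : q.val + 2 = t.val, hq⟩ := mem_dirtyAncilla.1 hqg
  have hqt' := le_of_mem_support_rung hqh
  rcases lt_trichotomy t.val t'.val with hlt | he | hlt
  · have := add_le_of_mod_eq hlt (ht.trans ht'.symm)
    omega
  · rw [Fin.ext he] at hq
    exact hq hqh
  · have := add_le_of_mod_eq hlt (ht'.trans ht.symm)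
    omega

theorem exists_eq_rung_of_mem_rungLayer (hs : 0 < s) (hr : r = 0 ∨ r = 2 * s) {g : MCX N}
    (hg : g ∈ rungLayer N s r) :
    ∃ t : Fin N, 2 * s ≤ t.val ∧ t.val % 2 = 0 ∧ g = rung s t := by
  obtain ⟨t, ⟨ht, ht0⟩, rfl⟩ := mem_rungLayer.1 hg
  have hdvd : 2 * s ∣ t.val := Nat.dvd_of_mod_eq_zero
    ((mod_two_mul_eq_zero_iff hs _).2 (hr.imp ht.trans ht.trans))
  exact ⟨t, Nat.le_of_dvd ht0 hdvd, Nat.mod_eq_zero_of_dvd (dvd_of_mul_right_dvd hdvd), rfl⟩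

theorem exists_run_eq_rung_act {d : ℕ} {t : Fin N} (hN : N ≤ 2 ^ d) (hs : 0 < s)
    (hst : 2 * s ≤ t.val) (ht : t.val % 2 = 0) :
    ∃ c : Circuit N, Bounded ((rung s t).support ∪ dirtyAncilla (rung s t)) (36 * d + 20)
      (12 * (rung s t).support.card) c ∧ c.run = (rung s t).act := by
  rcases (show s = 1 ∨ 2 ≤ s by omega) with rfl | hs2
  · have hcard : 0 < (rung 1 t).support.card :=
      Finset.card_pos.2 ⟨_, (rung 1 t).target_mem_support⟩
    exact ⟨[rung 1 t], (Bounded.singleton (isToffoliOrX_rung_one hst ht)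
      Finset.subset_union_left).mono le_rfl (by omega) (by omega), rfl⟩
  · have ha : (⟨t.val - 2, by omega⟩ : Fin N) ∉ (rung s t).support := by
      rw [mem_support_rung, mem_controls_rung, Fin.ext_iff]
      dsimp only
      omega
    have hcard : (rung s t).controls.card ≤ 2 ^ d := (card_finset_fin_le _).trans hN
    obtain ⟨c, hc, hrun⟩ := exists_run_eq_act ha (three_le_card_controls_rung hs2 hst ht) hcard
    have hmem : (⟨t.val - 2, by omega⟩ : Fin N) ∈ dirtyAncilla (rung s t) :=
      mem_dirtyAncilla.2 ⟨Nat.sub_add_cancel (by omega), ha⟩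
    exact ⟨c, hc.mono (Finset.insert_subset (Finset.mem_union_right _ hmem)
      Finset.subset_union_left) le_rfl le_rfl, hrun⟩

theorem exists_realisation_ladderLayers {d k : ℕ} (hs : 0 < s) (hN : N ≤ 2 ^ d) :
    ∃ R, List.Forall₂ RealisesLayer R (ladderLayers N k s) ∧
      Bounded Finset.univ (2 * k * (36 * d + 20)) (2 * k * (12 * N)) R.flatten ∧
      run R.flatten = run (ladderLayers N k s).flatten := by
  rw [← length_ladderLayers N k s]
  refine exists_forall₂_realisesLayer fun l hl => ?_
  obtain ⟨s', r, hs', hr, rfl⟩ := exists_eq_rungLayer_of_mem_ladderLayers hs hl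
  have hlayer := isLayer_rungLayer N s' r
  refine hlayer.exists_realisesLayer (pairwise_disjoint_dirtyAncilla hlayer)
    (fun g hg h hh => disjoint_dirtyAncilla_support hs' hg hh) fun g hg => ?_
  obtain ⟨t, hst, ht, rfl⟩ := exists_eq_rung_of_mem_rungLayer hs' hr hg
  exact exists_run_eq_rung_act hN hs' hst ht

end dirtyAncilla

section ladderTwo

open Circuit

variable {n k : ℕ}

theorem op_eq_ladderTwo {c : Circuit (2 * n + 1)} (h : c.run = strideLadder 1) :
    c.op = ladderTwo n := by
  rw [op_eq_basisOp_run, h, strideLadder_one, ladderTwo]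

theorem run_ladderLayers_one (hn : n < 2 ^ k) :
    run (ladderLayers (2 * n + 1) k 1).flatten = strideLadder 1 :=
  run_ladderLayers one_pos (by omega)

theorem exists_realisation_ladderTwo (hn : n < 2 ^ k) (hk : 0 < k) :
    ∃ R, List.Forall₂ RealisesLayer R (ladderLayers (2 * n + 1) k 1) ∧
      IsToffoliX R.flatten ∧ op R.flatten = ladderTwo n ∧
      depth R.flatten ≤ 184 * k ^ 2 ∧ R.flatten.length ≤ 24 * ((2 * n + 1) * k) := by
  obtain ⟨R, hR, hbounded, hrun⟩ := exists_realisation_ladderLayers (N := 2 * n + 1) (k := k)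
    (d := k + 1) one_pos (by rw [pow_succ]; omega)
  refine ⟨R, hR, hbounded.isToffoliX, op_eq_ladderTwo (hrun.trans (run_ladderLayers_one hn)),
    hbounded.depth_le.trans ?_, hbounded.length_le.trans_eq (by ring)⟩
  calc 2 * k * (36 * (k + 1) + 20) ≤ 2 * k * (92 * k) := Nat.mul_le_mul_left _ (by omega)
    _ = 184 * k ^ 2 := by ring

end ladderTwo

theorem isBigO_natCast_of_le_mul {α : Type*} {l : Filter α} {f g : α → ℕ} {C : ℕ}
    (h : ∀ᶠ a in l, f a ≤ C * g a) : (fun a => (f a : ℝ)) =O[l] fun a => (g a : ℝ) :=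
  .of_bound C <| h.mono fun a ha => by
    rw [Real.norm_natCast, Real.norm_natCast]
    exact_mod_cast ha

theorem natLog_succ_isBigO_logb {b : ℕ} (hb : 1 < b) :
    (fun n : ℕ => ((Nat.log b n + 1 : ℕ) : ℝ)) =O[Filter.atTop] fun n : ℕ => Real.logb b n := by
  refine (isBigO_natCast_of_le_mul (g := fun n => Nat.log b n) (C := 2) ?_).trans (.of_norm_le ?_)
  · filter_upwards [Filter.eventually_ge_atTop b] with n hn
    have := Nat.log_pos hb hn
    omega
  · intro n
    rw [Real.norm_natCast]
    exact Real.natLog_le_logb n b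

end QCirc

open QCirc QCirc.Circuit in
theorem mainTheorem4 :
    ∃ (C : (n : ℕ) → QCirc.Circuit (2 * n + 1))
      (L : (n : ℕ) → List (QCirc.Circuit (2 * n + 1))),
      (∀ n, (C n).IsToffoliX) ∧
      (∀ n, (C n).op = QCirc.ladderTwo n) ∧
      (fun n => ((C n).depth : ℝ)) =O[Filter.atTop] (fun n : ℕ => (Real.logb 2 n) ^ 2) ∧
      (fun n => ((C n).length : ℝ)) =O[Filter.atTop] (fun n : ℕ => (n : ℝ) * Real.logb 2 n) ∧
      (∀ n, (∀ l ∈ L n, QCirc.Circuit.IsLayer l) ∧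
        QCirc.Circuit.op (L n).flatten = QCirc.ladderTwo n) ∧
      (fun n => ((L n).length : ℝ)) =O[Filter.atTop] (fun n : ℕ => Real.logb 2 n) ∧
      (∀ n, ∃ R : List (QCirc.Circuit (2 * n + 1)),
        List.Forall₂ QCirc.Circuit.RealisesLayer R (L n) ∧ C n = R.flatten) := by
  have hn (n : ℕ) : n < 2 ^ (Nat.log 2 n + 1) := Nat.lt_pow_succ_log_self one_lt_two n
  have hlog := natLog_succ_isBigO_logb one_lt_two
  choose R hR htoffoli hop hdepth hlength using
    fun n => exists_realisation_ladderTwo (hn n) (Nat.succ_pos _)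
  refine ⟨fun n => (R n).flatten, fun n => ladderLayers (2 * n + 1) (Nat.log 2 n + 1) 1, htoffoli,
    hop, ?_, ?_, fun n => ⟨fun l => isLayer_of_mem_ladderLayers one_pos,
      op_eq_ladderTwo (run_ladderLayers_one (hn n))⟩, ?_, fun n => ⟨R n, hR n, rfl⟩⟩
  · refine (isBigO_natCast_of_le_mul (.of_forall hdepth)).trans ?_
    simpa only [Nat.cast_pow, Nat.cast_ofNat] using hlog.pow 2
  · have hodd : (fun n : ℕ => ((2 * n + 1 : ℕ) : ℝ)) =O[Filter.atTop] fun n : ℕ => (n : ℝ) :=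
      isBigO_natCast_of_le_mul (C := 3) <| (Filter.eventually_ge_atTop 1).mono fun n _ => by omega
    refine (isBigO_natCast_of_le_mul (.of_forall hlength)).trans ?_
    simpa only [Nat.cast_mul, Nat.cast_ofNat] using hodd.mul hlog
  · refine (isBigO_natCast_of_le_mul (C := 2) (.of_forall fun n => ?_)).trans hlog
    exact (length_ladderLayers ..).le
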